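/- Let $K/F/\mathbb{Q}_p$ be finite field extensions with rings of integers $\mathcal{O}_K$, $\mathcal{O}_F$, let $q$ be the cardinality of the residue field of $F$ and $\pi$ a uniformizer of $\mathcal{O}_F$, and let $A$ be a finite quotient ring of $\mathcal{O}_K$. Let $\Phi(t)\in\mathcal{O}_F[[t]]$ be a Lubin--Tate power series for $\pi$, i.e. $\Phi(t)\equiv \pi t$ modulo terms of degree $\ge 2$ and $\Phi(t)\equiv t^q$ modulo $\pi$. Put $\Gamma=\mathcal{O}_F^\times$, and for $\gamma\in\Gamma$ let $[\gamma]_\Phi(t)\in\mathcal{O}_F[[t]]$ be the unique power series with $[\gamma]_\Phi(t)\equiv\gamma t$ modulo terms of degree $\geq 2$ and $\Phi([\gamma]_\Phi(t))=[\gamma]_\Phi(\Phi(t))$. Let $D$ be a finite set, and put $A[[t_\bullet]]=A[[t_d]]_{d\in D}$ and $A((t_\bullet))=A[[t_\bullet]][\prod_{d\in D}t_d^{-1}]$. For $d\in D$ let $\varphi_d$, resp. $\gamma_d$ (for $\gamma\in\Gamma$), act on $A((t_\bullet))$ by the $A$-algebra endomorphism which inserts $\Phi(t_d)$, resp. $[\gamma]_\Phi(t_d)$,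 for $t_d$ and fixes $t_{d'}$ for all $d'\neq d$. These endomorphisms define an action of the commutative monoid $\prod_{d\in D}(\varphi_d^{\mathbb{N}}\times\Gamma)$ on $A((t_\bullet))$. Let $A((t_\bullet))[\varphi_\bullet,\Gamma_\bullet]$ be the corresponding skew monoid ring: it is the free left $A((t_\bullet))$-module on this monoid, with multiplication determined by the multiplication of the monoid and by $m\cdot f=m(f)\cdot m$ for $f\in A((t_\bullet))$ and $m$ in the monoid. An étale $(\varphi_\bullet,\Gamma_\bullet)$-module over $A((t_\bullet))$ is a (left) $A((t_\bullet))[\varphi_\bullet,\Gamma_\bullet]$-module $\mathbf{D}$ which is finitely generated over $A((t_\bullet))$ and such that for each $d\in D$ the linearized map $$\mathrm{id}\otimes\varphi_d:\ A((t_\bullet))\otimes_{\varphi_d,A((t_\bullet))}\mathbf{D}\longrightarrow\mathbf{D},\qquad r\otimes x\mapsto r\,\varphi_d(x),$$ is bijective. Morphisms are the $A((t_\bullet))[\varphi_\bullet,\Gamma_\bullet]$-linear maps. Then the category of étale $(\varphi_\bullet,\Gamma_\bullet)$-modules over $A((t_\bullet))$ (with its usual addition of morphisms) is abelian. -/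

import Mathlib

open scoped PowerSeries TensorProduct
open CategoryTheory

universe v

namespace LubinTate

section Series

variable {O : Type*} [CommRing O]

lemma coeff_subst_sub {Φ f g : O⟦X⟧} (hf : f.constantCoeff = 0) (hg : g.constantCoeff = 0)
    {n : ℕ} (h : ∀ i < n, f.coeff i = g.coeff i) :
    PowerSeries.coeff n (PowerSeries.subst f Φ) - PowerSeries.coeff n (PowerSeries.subst g Φ) =
      Φ.coeff 1 * (f.coeff n - g.coeff n) := by
  have hsf := PowerSeries.HasSubst.of_constantCoeff_zero' hf
  have hsg := PowerSeries.HasSubst.of_constantCoeff_zero' hg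
  rw [PowerSeries.coeff_subst' hsf, PowerSeries.coeff_subst' hsg,
    ← finsum_sub_distrib (PowerSeries.coeff_subst_finite' hsf Φ n)
      (PowerSeries.coeff_subst_finite' hsg Φ n), finsum_eq_single _ 1]
  · simp [mul_sub]
  · intro d hd
    obtain ⟨u, hu⟩ : (PowerSeries.X : O⟦X⟧) ^ n ∣ f - g :=
      PowerSeries.X_pow_dvd_iff.mpr fun m hm => by simp [h m hm]
    rcases d with _ | _ | d
    · simp
    · exact absurd rfl hd
    · rw [← smul_sub, ← map_sub, ← (Commute.all f g).mul_geom_sum₂ (d + 1 + 1)]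
      have hX : ∀ i, (PowerSeries.X : O⟦X⟧) ∣ f ^ i * g ^ (d + 1 + 1 - 1 - i) ∨
          d + 1 + 1 ≤ i := by
        intro i
        rcases Nat.eq_zero_or_pos i with rfl | hi
        · exact Or.inl ((dvd_pow (PowerSeries.X_dvd_iff.mpr hg) (by omega)).mul_left _)
        · exact Or.inl ((dvd_pow (PowerSeries.X_dvd_iff.mpr hf) (by omega)).mul_right _)
      have h2 : (PowerSeries.X : O⟦X⟧) ∣
          ∑ i ∈ Finset.range (d + 1 + 1), f ^ i * g ^ (d + 1 + 1 - 1 - i) :=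
        Finset.dvd_sum fun i hi => (hX i).resolve_right (by simpa using hi)
      have h3 : (PowerSeries.X : O⟦X⟧) ^ (n + 1) ∣
          (f - g) * ∑ i ∈ Finset.range (d + 1 + 1), f ^ i * g ^ (d + 1 + 1 - 1 - i) := by
        rw [pow_succ]
        exact mul_dvd_mul ⟨u, hu⟩ h2
      rw [PowerSeries.X_pow_dvd_iff.mp h3 n (by omega), smul_zero]

lemma coeff_subst_of_dvd {Φ h : O⟦X⟧} (hΦ : Φ.constantCoeff = 0)
    {n : ℕ} (hh : ∀ i < n, h.coeff i = 0) :
    PowerSeries.coeff n (PowerSeries.subst Φ h) = h.coeff n * (Φ.coeff 1) ^ n := by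
  obtain ⟨v, hv⟩ := PowerSeries.X_dvd_iff.mpr hΦ
  have hd : ∀ d, Φ ^ d = PowerSeries.X ^ d * v ^ d := fun d => by rw [hv, mul_pow]
  rw [PowerSeries.coeff_subst' (PowerSeries.HasSubst.of_constantCoeff_zero' hΦ),
    finsum_eq_single _ n]
  · have h1 : Φ.coeff 1 = v.constantCoeff := by
      rw [hv]; simp
    rw [hd, smul_eq_mul, h1]
    congr 1
    simpa using PowerSeries.coeff_X_pow_mul (v ^ n) n 0
  · intro d hdn
    rcases lt_or_gt_of_ne hdn with hlt | hgt
    · rw [hh d hlt, zero_smul]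
    · rw [hd, PowerSeries.coeff_X_pow_mul', if_neg (by omega), smul_zero]

lemma subst_assoc {f g h : O⟦X⟧} (hg : g.constantCoeff = 0) (hh : h.constantCoeff = 0) :
    PowerSeries.subst h (PowerSeries.subst g f) =
      PowerSeries.subst (PowerSeries.subst h g) f :=
  PowerSeries.subst_comp_subst_apply (PowerSeries.HasSubst.of_constantCoeff_zero' hg)
    (PowerSeries.HasSubst.of_constantCoeff_zero' hh) f

lemma constantCoeff_subst' {g f : O⟦X⟧} (hg : g.constantCoeff = 0) (hf : f.constantCoeff = 0) :
    PowerSeries.constantCoeff (PowerSeries.subst g f) = 0 :=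
  PowerSeries.constantCoeff_subst_eq_zero hg f hf

lemma coeff_one_subst {g f : O⟦X⟧} (hg : g.constantCoeff = 0) (hf : f.constantCoeff = 0) :
    PowerSeries.coeff 1 (PowerSeries.subst g f) = f.coeff 1 * g.coeff 1 := by
  have := coeff_subst_of_dvd (n := 1) (h := f) hg (by
    intro i hi
    obtain rfl : i = 0 := by omega
    simpa using hf)
  simpa using this

end Series

section LubinTate

variable {O : Type*} [CommRing O] [IsDomain O] [IsDiscreteValuationRing O]

/-- `Φ` is a Lubin-Tate series for the uniformizer `π` of the discrete valuation ring `O` with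
finite residue field of cardinality `q`: `Φ ≡ π t` modulo degree two and `Φ ≡ t ^ q` modulo `π`. -/
structure IsLubinTateSeries (π : O) (Φ : O⟦X⟧) : Prop where
  constantCoeff_eq : Φ.constantCoeff = 0
  coeff_one_eq : Φ.coeff 1 = π
  dvd_coeff : ∀ n, π ∣ (Φ - PowerSeries.X ^ Nat.card (IsLocalRing.ResidueField O)).coeff n

/-- `f = [a]_Φ`: the series `f` has no constant term, linear coefficient `a`, and commutes with
`Φ` under composition. -/
structure IsLubinTateMul (Φ : O⟦X⟧) (a : O) (f : O⟦X⟧) : Prop where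
  constantCoeff_eq : f.constantCoeff = 0
  coeff_one_eq : f.coeff 1 = a
  comm : PowerSeries.subst f Φ = PowerSeries.subst Φ f

variable {π : O} {Φ : O⟦X⟧}

lemma isUnit_one_sub_pow (hπ : Irreducible π) {m : ℕ} (hm : m ≠ 0) : IsUnit (1 - π ^ m) := by
  rw [← neg_sub, IsUnit.neg_iff]
  have h1 : π ^ m ∈ IsLocalRing.maximalIdeal O :=
    Ideal.pow_mem_of_mem _ ((IsLocalRing.mem_maximalIdeal _).mpr hπ.not_isUnit) m (by omega)
  by_contra h
  have h2 : π ^ m - 1 ∈ IsLocalRing.maximalIdeal O := (IsLocalRing.mem_maximalIdeal _).mpr h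
  have h3 := Ideal.sub_mem _ h1 h2
  simp only [sub_sub_cancel] at h3
  exact (IsLocalRing.mem_maximalIdeal _).mp h3 isUnit_one

lemma IsLubinTateMul.unique (hπ : Irreducible π) (hΦ : IsLubinTateSeries π Φ) {a : O}
    {f g : O⟦X⟧} (hf : IsLubinTateMul Φ a f) (hg : IsLubinTateMul Φ a g) : f = g := by
  ext n
  induction n using Nat.strong_induction_on with
  | _ n ih =>
    rcases n with _ | _ | n
    · simpa using hf.constantCoeff_eq.trans hg.constantCoeff_eq.symm
    · simpa using hf.coeff_one_eq.trans hg.coeff_one_eq.symm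
    · have h1 := coeff_subst_sub (Φ := Φ) hf.constantCoeff_eq hg.constantCoeff_eq
        (n := n + 1 + 1) ih
      have h2 := coeff_subst_of_dvd (Φ := Φ) (h := f - g) hΦ.constantCoeff_eq (n := n + 1 + 1)
        (fun i hi => by simp [ih i hi])
      rw [PowerSeries.subst_sub
        (PowerSeries.HasSubst.of_constantCoeff_zero' hΦ.constantCoeff_eq)] at h2
      rw [hf.comm, hg.comm, ← map_sub, h2, hΦ.coeff_one_eq, map_sub] at h1
      have h3 : π * (1 - π ^ (n + 1)) *
          (f.coeff (n + 1 + 1) - g.coeff (n + 1 + 1)) = 0 := by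
        linear_combination -h1
      rcases mul_eq_zero.mp h3 with h | h
      · exact absurd h (mul_ne_zero hπ.ne_zero (isUnit_one_sub_pow hπ (by omega)).ne_zero)
      · exact sub_eq_zero.mp h

lemma residue_eq_zero_iff (hπ : Irreducible π) (x : O) :
    IsLocalRing.residue O x = 0 ↔ π ∣ x := by
  rw [IsLocalRing.residue_eq_zero_iff, hπ.maximalIdeal_eq, Ideal.mem_span_singleton]

lemma pow_card_eq_subst {k : Type*} [Field k] [Finite k] (g : k⟦X⟧) :
    PowerSeries.subst (PowerSeries.X ^ Nat.card k : k⟦X⟧) g = g ^ Nat.card k := by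
  have := Fintype.ofFinite k
  obtain ⟨p, hp⟩ := CharP.exists k
  obtain ⟨n, hpp, hn⟩ := FiniteField.card k p
  have : Fact p.Prime := ⟨hpp⟩
  have hq : Nat.card k = p ^ (n : ℕ) := by rw [Nat.card_eq_fintype_card, hn]
  have h1 : iterateFrobenius k p n = RingHom.id k := by
    ext x
    simp [iterateFrobenius_def, ← hn, FiniteField.pow_card]
  have h2 := MvPowerSeries.map_iterateFrobenius_expand (σ := Unit) (R := k) p
    (Fact.out : p.Prime).ne_zero g n
  rw [h1, MvPowerSeries.map_id, RingHom.id_apply] at h2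
  rw [hq, ← PowerSeries.expand_apply _ (pow_ne_zero _ hpp.ne_zero)]
  exact h2

variable [Finite (IsLocalRing.ResidueField O)]

lemma dvd_coeff_comm (hπ : Irreducible π) (hΦ : IsLubinTateSeries π Φ) {g : O⟦X⟧}
    (hg : g.constantCoeff = 0) (n : ℕ) :
    π ∣ PowerSeries.coeff n (PowerSeries.subst g Φ - PowerSeries.subst Φ g) := by
  have hq : Nat.card (IsLocalRing.ResidueField O) ≠ 0 := Nat.card_pos.ne'
  rw [← residue_eq_zero_iff hπ, ← PowerSeries.coeff_map, map_sub]
  have hΦm : Φ.map (IsLocalRing.residue O) =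
      PowerSeries.X ^ Nat.card (IsLocalRing.ResidueField O) := by
    ext m
    have := (residue_eq_zero_iff hπ _).mpr (hΦ.dvd_coeff m)
    rw [map_sub, map_sub, sub_eq_zero] at this
    rw [PowerSeries.coeff_map, this, PowerSeries.coeff_X_pow, PowerSeries.coeff_X_pow]
    split_ifs <;> simp
  have e1 := PowerSeries.map_subst (PowerSeries.HasSubst.of_constantCoeff_zero' hg)
    (h := IsLocalRing.residue O) Φ
  have e2 := PowerSeries.map_subst
    (PowerSeries.HasSubst.of_constantCoeff_zero' hΦ.constantCoeff_eq)
    (h := IsLocalRing.residue O) g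
  have hg' : (g.map (IsLocalRing.residue O)).constantCoeff = 0 := by
    rw [← PowerSeries.coeff_zero_eq_constantCoeff_apply, PowerSeries.coeff_map]
    simp [hg]
  change PowerSeries.map _ _ = PowerSeries.subst (PowerSeries.map _ _) _ at e1
  change PowerSeries.map _ _ = PowerSeries.subst (PowerSeries.map _ _) _ at e2
  rw [e1, e2, hΦm, pow_card_eq_subst,
    PowerSeries.subst_pow (PowerSeries.HasSubst.of_constantCoeff_zero' hg'),
    PowerSeries.subst_X (PowerSeries.HasSubst.of_constantCoeff_zero' hg')]
  rw [sub_self, map_zero]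

lemma exists_isLubinTateMul (hπ : Irreducible π) (hΦ : IsLubinTateSeries π Φ) (a : O) :
    ∃ f, IsLubinTateMul Φ a f := by
  have hex : ∀ (n : ℕ) (g : O⟦X⟧), ∃ c : O, g.constantCoeff = 0 → 2 ≤ n →
      PowerSeries.coeff n (PowerSeries.subst g Φ - PowerSeries.subst Φ g) + (π - π ^ n) * c = 0 := by
    intro n g
    by_cases hgn : g.constantCoeff = 0 ∧ 2 ≤ n
    · obtain ⟨b, hb⟩ := dvd_coeff_comm hπ hΦ hgn.1 n
      obtain ⟨u, hu⟩ := isUnit_one_sub_pow hπ (m := n - 1) (by omega)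
      refine ⟨-(b * (↑u⁻¹ : O)), fun _ _ => ?_⟩
      have h1 : π - π ^ n = π * (1 - π ^ (n - 1)) := by
        obtain ⟨m, rfl⟩ : ∃ m, n = m + 1 := ⟨n - 1, by omega⟩
        simp only [Nat.add_sub_cancel]
        ring
      rw [hb, h1, ← hu]
      linear_combination (-π * b) * (Units.mul_inv u)
    · exact ⟨0, fun h1 h2 => absurd ⟨h1, h2⟩ hgn⟩
  choose c hc using hex
  let s : ℕ → O⟦X⟧ := fun n => Nat.rec 0 (fun m g => g + PowerSeries.monomial m
    (if m = 0 then 0 else if m = 1 then a else c m g)) n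
  have hs : ∀ m, s (m + 1) = s m + PowerSeries.monomial m
    (if m = 0 then 0 else if m = 1 then a else c m (s m)) := fun m => rfl
  have hs0 : ∀ m i, m ≤ i → (s m).coeff i = 0 := by
    intro m
    induction m with
    | zero => intro i _; simp [s]
    | succ m ih =>
      intro i hi
      rw [hs, map_add, ih i (by omega), PowerSeries.coeff_monomial, if_neg (by omega), add_zero]
  have hs1 : ∀ m i, i < m → (s m).coeff i = (s (i + 1)).coeff i := by
    intro m
    induction m with
    | zero => intro i hi; omega
    | succ m ih =>
      intro i hi
      rcases Nat.lt_succ_iff_lt_or_eq.mp hi with h | rfl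
      · rw [hs, map_add, ih i h, PowerSeries.coeff_monomial, if_neg (by omega), add_zero]
      · rfl
  let f : O⟦X⟧ := PowerSeries.mk fun i => (s (i + 1)).coeff i
  have hfs : ∀ m i, i < m → f.coeff i = (s m).coeff i := fun m i hi => by
    rw [PowerSeries.coeff_mk, hs1 m i hi]
  have hfc : ∀ m, f.coeff m = if m = 0 then 0 else if m = 1 then a else c m (s m) := by
    intro m
    rw [PowerSeries.coeff_mk, hs, map_add, hs0 m m le_rfl, PowerSeries.coeff_monomial, if_pos rfl,
      zero_add]
  have hf0 : f.constantCoeff = 0 := by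
    rw [← PowerSeries.coeff_zero_eq_constantCoeff_apply, hfc, if_pos rfl]
  have hf1 : f.coeff 1 = a := by rw [hfc]; simp
  refine ⟨f, hf0, hf1, ?_⟩
  ext n
  rcases Nat.lt_or_ge n 2 with hn | hn
  · interval_cases n
    · rw [PowerSeries.coeff_zero_eq_constantCoeff_apply,
        PowerSeries.coeff_zero_eq_constantCoeff_apply,
        constantCoeff_subst' hf0 hΦ.constantCoeff_eq, constantCoeff_subst' hΦ.constantCoeff_eq hf0]
    · rw [coeff_one_subst hf0 hΦ.constantCoeff_eq, coeff_one_subst hΦ.constantCoeff_eq hf0, mul_comm]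
  · have hsn0 : (s n).constantCoeff = 0 := by
      rw [← PowerSeries.coeff_zero_eq_constantCoeff_apply, ← hfs n 0 (by omega), hfc, if_pos rfl]
    have h1 := coeff_subst_sub (Φ := Φ) hf0 hsn0 (n := n) (hfs n)
    have h2 := coeff_subst_of_dvd (Φ := Φ) (h := f - s n) hΦ.constantCoeff_eq (n := n)
      (fun i hi => by simp [hfs n i hi])
    rw [PowerSeries.subst_sub
      (PowerSeries.HasSubst.of_constantCoeff_zero' hΦ.constantCoeff_eq)] at h2
    have h3 := hc n (s n) hsn0 hn
    rw [hs0 n n le_rfl, sub_zero, hfc n, if_neg (by omega), if_neg (by omega),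
      hΦ.coeff_one_eq] at h1
    change PowerSeries.coeff n _ = _ at h2
    rw [map_sub, map_sub, hs0 n n le_rfl, sub_zero, hfc n, if_neg (by omega), if_neg (by omega),
      hΦ.coeff_one_eq] at h2
    rw [map_sub] at h3
    linear_combination h1 - h2 + h3

/-- The power series `[a]_Φ` describing multiplication by `a` in the Lubin-Tate group. -/
noncomputable def lubinTateMul (hπ : Irreducible π) (hΦ : IsLubinTateSeries π Φ) (a : O) : O⟦X⟧ :=
  (exists_isLubinTateMul hπ hΦ a).choose

lemma lubinTateMul_spec (hπ : Irreducible π) (hΦ : IsLubinTateSeries π Φ) (a : O) :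
    IsLubinTateMul Φ a (lubinTateMul hπ hΦ a) :=
  (exists_isLubinTateMul hπ hΦ a).choose_spec

lemma lubinTateMul_uniformizer (hπ : Irreducible π) (hΦ : IsLubinTateSeries π Φ) :
    lubinTateMul hπ hΦ π = Φ :=
  (lubinTateMul_spec hπ hΦ π).unique hπ hΦ ⟨hΦ.constantCoeff_eq, hΦ.coeff_one_eq, rfl⟩

lemma lubinTateMul_one (hπ : Irreducible π) (hΦ : IsLubinTateSeries π Φ) :
    lubinTateMul hπ hΦ 1 = PowerSeries.X :=
  (lubinTateMul_spec hπ hΦ 1).unique hπ hΦ ⟨by simp, by simp, by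
    rw [PowerSeries.X_subst, PowerSeries.subst_X
      (PowerSeries.HasSubst.of_constantCoeff_zero' hΦ.constantCoeff_eq)]⟩

lemma lubinTateMul_mul (hπ : Irreducible π) (hΦ : IsLubinTateSeries π Φ) (a b : O) :
    lubinTateMul hπ hΦ (a * b) =
      PowerSeries.subst (lubinTateMul hπ hΦ b) (lubinTateMul hπ hΦ a) := by
  have ha := lubinTateMul_spec hπ hΦ a
  have hb := lubinTateMul_spec hπ hΦ b
  refine (lubinTateMul_spec hπ hΦ (a * b)).unique hπ hΦ
    ⟨constantCoeff_subst' hb.constantCoeff_eq ha.constantCoeff_eq, ?_, ?_⟩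
  · rw [coeff_one_subst hb.constantCoeff_eq ha.constantCoeff_eq, ha.coeff_one_eq, hb.coeff_one_eq]
  · rw [← subst_assoc ha.constantCoeff_eq hb.constantCoeff_eq, ha.comm,
      subst_assoc hΦ.constantCoeff_eq hb.constantCoeff_eq, hb.comm,
      subst_assoc hb.constantCoeff_eq hΦ.constantCoeff_eq]

end LubinTate

end LubinTate

namespace LubinTate
section Integers

variable {p : ℕ} [Fact p.Prime] {F : Type*} [Field F] [Algebra ℚ_[p] F]
  [Algebra ℤ_[p] F] [IsScalarTower ℤ_[p] ℚ_[p] F]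

lemma isIntegral_iff_spectralNorm_le_one [Algebra.IsAlgebraic ℚ_[p] F] (x : F) :
    IsIntegral ℤ_[p] x ↔ spectralNorm ℚ_[p] F x ≤ 1 := by
  have hx : IsIntegral ℚ_[p] x := Algebra.IsIntegral.isIntegral x
  rw [spectralNorm, spectralValue_le_one_iff (minpoly.monic hx)]
  constructor
  · intro h n
    have := minpoly.isIntegrallyClosed_eq_field_fractions (S := F) ℚ_[p] F h
    rw [Algebra.algebraMap_self, RingHom.id_apply] at this
    rw [this, Polynomial.coeff_map]
    exact ((minpoly ℤ_[p] x).coeff n).2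
  · intro h
    have hl : minpoly ℚ_[p] x ∈ Polynomial.lifts (algebraMap ℤ_[p] ℚ_[p]) :=
      (Polynomial.lifts_iff_coeff_lifts _).mpr fun n => ⟨⟨_, h n⟩, rfl⟩
    obtain ⟨P, hP, -, hPm⟩ := Polynomial.lifts_and_degree_eq_and_monic hl (minpoly.monic hx)
    refine ⟨P, hPm, ?_⟩
    have := minpoly.aeval ℚ_[p] x
    rw [← hP, Polynomial.aeval_map_algebraMap] at this
    exact this

variable {K : Type*} [Field K] [Algebra ℚ_[p] K] [Algebra ℤ_[p] K]
  [IsScalarTower ℤ_[p] ℚ_[p] K] [Algebra F K] [IsScalarTower ℚ_[p] F K]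

variable (p F K) in
/-- The inclusion `𝓞_F → 𝓞_K` of rings of integers. -/
noncomputable def integersMap : integralClosure ℤ_[p] F →+* integralClosure ℤ_[p] K :=
  have : IsScalarTower ℤ_[p] F K := IsScalarTower.of_algebraMap_eq fun x => by
    rw [IsScalarTower.algebraMap_apply ℤ_[p] ℚ_[p] K, IsScalarTower.algebraMap_apply ℚ_[p] F K,
      IsScalarTower.algebraMap_apply ℤ_[p] ℚ_[p] F]
  (algebraMap F K).restrict _ _ fun x hx => hx.algebraMap

@[simp]
lemma coe_integersMap (x : integralClosure ℤ_[p] F) :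
    (integersMap p F K x : K) = algebraMap F K x := rfl

variable [FiniteDimensional ℚ_[p] F]

lemma isUnit_iff_spectralNorm_eq_one (x : integralClosure ℤ_[p] F) :
    IsUnit x ↔ spectralNorm ℚ_[p] F (x : F) = 1 := by
  have hm : ∀ y z : F, spectralNorm ℚ_[p] F (y * z) =
      spectralNorm ℚ_[p] F y * spectralNorm ℚ_[p] F z :=
    fun y z => map_mul (spectralMulAlgNorm ℚ_[p] F) y z
  have h1 : spectralNorm ℚ_[p] F (1 : F) = 1 := spectralNorm_one
  constructor
  · rintro ⟨u, rfl⟩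
    have ha := (isIntegral_iff_spectralNorm_le_one (p := p) _).mp (u : integralClosure ℤ_[p] F).2
    have hb := (isIntegral_iff_spectralNorm_le_one (p := p) _).mp
      ((u⁻¹ : (integralClosure ℤ_[p] F)ˣ) : integralClosure ℤ_[p] F).2
    have hab : ((u : integralClosure ℤ_[p] F) : F) *
        ((u⁻¹ : (integralClosure ℤ_[p] F)ˣ) : integralClosure ℤ_[p] F) = 1 := by
      exact_mod_cast congrArg Subtype.val (Units.mul_inv u)
    have := hm ((u : integralClosure ℤ_[p] F) : F)
      ((u⁻¹ : (integralClosure ℤ_[p] F)ˣ) : integralClosure ℤ_[p] F)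
    rw [hab, h1] at this
    nlinarith [spectralNorm_nonneg (K := ℚ_[p]) ((u : integralClosure ℤ_[p] F) : F)]
  · intro h
    have h0 : (x : F) ≠ 0 := by
      intro h0
      rw [h0, spectralNorm_zero] at h
      exact zero_ne_one h
    have hi : IsIntegral ℤ_[p] (x : F)⁻¹ := by
      rw [isIntegral_iff_spectralNorm_le_one (p := p)]
      have := hm (x : F) (x : F)⁻¹
      rw [mul_inv_cancel₀ h0, h1, h, one_mul] at this
      exact this.symm.le
    exact IsUnit.of_mul_eq_one (⟨_, hi⟩ : integralClosure ℤ_[p] F)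
      (Subtype.ext (mul_inv_cancel₀ h0))

instance isLocalRing_integers : IsLocalRing (integralClosure ℤ_[p] F) :=
  IsLocalRing.of_nonunits_add fun a b ha hb hab => by
    rw [mem_nonunits_iff, isUnit_iff_spectralNorm_eq_one] at ha hb
    rw [isUnit_iff_spectralNorm_eq_one] at hab
    have ha' := lt_of_le_of_ne ((isIntegral_iff_spectralNorm_le_one (p := p) _).mp a.2) ha
    have hb' := lt_of_le_of_ne ((isIntegral_iff_spectralNorm_le_one (p := p) _).mp b.2) hb
    have h := isNonarchimedean_spectralNorm (K := ℚ_[p]) (a : F) (b : F)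
    rw [← Subalgebra.coe_add, hab] at h
    exact absurd h (not_le.mpr (max_lt ha' hb'))

lemma charZero_of_padicAlgebra (p : ℕ) [Fact p.Prime] (F : Type*) [Field F] [Algebra ℚ_[p] F] :
    CharZero F := charZero_of_injective_algebraMap (algebraMap ℚ_[p] F).injective

instance finite_integers : Module.Finite ℤ_[p] (integralClosure ℤ_[p] F) :=
  have := charZero_of_padicAlgebra p F
  IsIntegralClosure.finite ℤ_[p] ℚ_[p] F _

instance faithfulSMul_integers : FaithfulSMul ℤ_[p] (integralClosure ℤ_[p] F) := by
  rw [faithfulSMul_iff_algebraMap_injective]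
  intro x y h
  have h2 := congrArg (algebraMap (integralClosure ℤ_[p] F) F) h
  rw [← IsScalarTower.algebraMap_apply, ← IsScalarTower.algebraMap_apply,
    IsScalarTower.algebraMap_apply ℤ_[p] ℚ_[p] F, IsScalarTower.algebraMap_apply ℤ_[p] ℚ_[p] F] at h2
  exact IsFractionRing.injective ℤ_[p] ℚ_[p] ((algebraMap ℚ_[p] F).injective h2)

instance isDiscreteValuationRing_integers :
    IsDiscreteValuationRing (integralClosure ℤ_[p] F) := by
  have := charZero_of_padicAlgebra p F
  have hD : IsDedekindDomain (integralClosure ℤ_[p] F) :=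
    integralClosure.isDedekindDomain ℤ_[p] ℚ_[p] F
  have hf : ¬ IsField (integralClosure ℤ_[p] F) := fun h => by
    have := isField_of_isIntegral_of_isField
      (FaithfulSMul.algebraMap_injective ℤ_[p] (integralClosure ℤ_[p] F)) h
    exact IsDiscreteValuationRing.not_isField ℤ_[p] this
  exact ((IsDiscreteValuationRing.TFAE _ hf).out 0 2).mpr hD

instance finite_residueField_integers :
    Finite (IsLocalRing.ResidueField (integralClosure ℤ_[p] F)) :=
  have : Finite (IsLocalRing.ResidueField ℤ_[p]) := inferInstance
  IsLocalRing.ResidueField.finite_of_finite this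

/-- A uniformizer of `F` is nilpotent in every finite quotient of `𝓞_K`. -/
lemma isNilpotent_uniformizer [FiniteDimensional ℚ_[p] K] {π : integralClosure ℤ_[p] F}
    (hπ : Irreducible π)
    {A : Type*} [CommRing A] [Finite A] {f : integralClosure ℤ_[p] K →+* A}
    (hf : Function.Surjective f) : IsNilpotent (f.comp (integersMap p F K) π) := by
  rcases subsingleton_or_nontrivial A with h | h
  · exact ⟨1, Subsingleton.elim _ _⟩
  · have hloc : IsLocalRing A := IsLocalRing.of_surjective' f hf
    have hnu : integersMap p F K π ∈ nonunits _ := by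
      intro hu
      rw [isUnit_iff_spectralNorm_eq_one, coe_integersMap] at hu
      refine hπ.not_isUnit ((isUnit_iff_spectralNorm_eq_one π).mpr ?_)
      rw [← hu, spectralNorm, spectralNorm, minpoly.algebraMap_eq (algebraMap F K).injective]
    have hn : IsUnit (f (integersMap p F K π)) → False := by
      intro hu
      have : IsLocalHom f := IsLocalHom.of_surjective f hf
      exact hnu (isUnit_of_map_unit f _ hu)
    have hm : f (integersMap p F K π) ∈ IsLocalRing.maximalIdeal A :=
      (IsLocalRing.mem_maximalIdeal _).mpr hn
    exact Ring.KrullDimLE.isNilpotent_iff_mem_maximalIdeal.mpr hm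

end Integers

section Ring

/-- `A((t_•)) = A[[t_d]]_{d ∈ D}[∏_d t_d⁻¹]`. -/
abbrev MvLaurent (D : Type*) [Fintype D] (A : Type*) [CommRing A] : Type _ :=
  Localization.Away (∏ d : D, (MvPowerSeries.X d : MvPowerSeries D A))

variable {O : Type*} [CommRing O] {A : Type*} [CommRing A] (ι : O →+* A)
  {D : Type*}

/-- The power series `s(t_d)`, with coefficients mapped to `A`. -/
noncomputable def inVar (s : O⟦X⟧) (d : D) : MvPowerSeries D A :=
  PowerSeries.subst (MvPowerSeries.X d : MvPowerSeries D A) (PowerSeries.map ι s)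

lemma constantCoeff_inVar {s : O⟦X⟧} (hs : s.constantCoeff = 0) (d : D) :
    MvPowerSeries.constantCoeff (inVar ι s d) = 0 :=
  PowerSeries.constantCoeff_subst_eq_zero (by simp) _ (by
    rw [← PowerSeries.coeff_zero_eq_constantCoeff_apply, PowerSeries.coeff_map]
    simp [hs])

variable [Fintype D]

lemma hasSubst_inVar {s : D → O⟦X⟧} (hs : ∀ d, (s d).constantCoeff = 0) :
    MvPowerSeries.HasSubst fun d => inVar ι (s d) d :=
  MvPowerSeries.hasSubst_of_constantCoeff_zero fun d => constantCoeff_inVar ι (hs d) d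

/-- The `A`-algebra endomorphism of `A[[t_•]]` inserting `s_d(t_d)` for `t_d`, for each `d`. -/
noncomputable def substEnd (s : D → O⟦X⟧) (hs : ∀ d, (s d).constantCoeff = 0) :
    MvPowerSeries D A →ₐ[A] MvPowerSeries D A :=
  MvPowerSeries.substAlgHom (hasSubst_inVar ι hs)

lemma substEnd_X (s : D → O⟦X⟧) (hs : ∀ d, (s d).constantCoeff = 0) (d : D) :
    substEnd ι s hs (MvPowerSeries.X d) = inVar ι (s d) d :=
  MvPowerSeries.substAlgHom_X _ d

lemma substEnd_inVar (s : D → O⟦X⟧) (hs : ∀ d, (s d).constantCoeff = 0) {u : O⟦X⟧} (d : D) :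
    substEnd ι s hs (inVar ι u d) = inVar ι (PowerSeries.subst (s d) u) d := by
  have hX : PowerSeries.HasSubst (MvPowerSeries.X d : MvPowerSeries D A) :=
    PowerSeries.HasSubst.of_constantCoeff_zero (by simp)
  have hsd := PowerSeries.HasSubst.of_constantCoeff_zero' (hs d)
  have hsm : PowerSeries.HasSubst (PowerSeries.map ι (s d)) :=
    PowerSeries.HasSubst.of_constantCoeff_zero' (by
      rw [← PowerSeries.coeff_zero_eq_constantCoeff_apply, PowerSeries.coeff_map]
      simp [hs d])
  have h1 : substEnd ι s hs (inVar ι u d) =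
      PowerSeries.subst (inVar ι (s d) d) (PowerSeries.map ι u) := by
    rw [substEnd, MvPowerSeries.substAlgHom_apply, inVar, PowerSeries.subst_def,
      MvPowerSeries.subst_comp_subst_apply hX.const (hasSubst_inVar ι hs),
      MvPowerSeries.subst_X (hasSubst_inVar ι hs), PowerSeries.subst_def]
  have h2 : PowerSeries.map ι (PowerSeries.subst (s d) u) =
      PowerSeries.subst (PowerSeries.map ι (s d)) (PowerSeries.map ι u) :=
    PowerSeries.map_subst hsd u
  rw [h1, inVar, inVar, h2, PowerSeries.subst_comp_subst_apply hsm hX]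

lemma substEnd_comp (s u : D → O⟦X⟧) (hs : ∀ d, (s d).constantCoeff = 0)
    (hu : ∀ d, (u d).constantCoeff = 0)
    (hsu : ∀ d, (PowerSeries.subst (s d) (u d) : O⟦X⟧).constantCoeff = 0)
    (f : MvPowerSeries D A) :
    substEnd ι s hs (substEnd ι u hu f) =
      substEnd ι (fun d => PowerSeries.subst (s d) (u d)) hsu f := by
  simp only [substEnd, MvPowerSeries.substAlgHom_apply]
  rw [MvPowerSeries.subst_comp_subst_apply (hasSubst_inVar ι hu) (hasSubst_inVar ι hs)]
  congr 1
  funext d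
  have := substEnd_inVar ι s hs (u := u d) d
  rwa [substEnd, MvPowerSeries.substAlgHom_apply] at this

lemma substEnd_id (f : MvPowerSeries D A) (hs : ∀ _ : D, (PowerSeries.X : O⟦X⟧).constantCoeff = 0) :
    substEnd ι (fun _ => PowerSeries.X) hs f = f := by
  have : (fun d : D => inVar ι (PowerSeries.X : O⟦X⟧) d) = MvPowerSeries.X := by
    funext d
    rw [inVar, PowerSeries.map_X, PowerSeries.subst_X
      (PowerSeries.HasSubst.of_constantCoeff_zero (by simp))]
  rw [substEnd, MvPowerSeries.substAlgHom_apply, this, MvPowerSeries.subst_self, id]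

lemma isUnit_algebraMap_X (d : D) :
    IsUnit (algebraMap (MvPowerSeries D A) (MvLaurent D A) (MvPowerSeries.X d)) := by
  have h := IsLocalization.Away.algebraMap_isUnit (S := MvLaurent D A)
    (∏ d : D, (MvPowerSeries.X d : MvPowerSeries D A))
  exact isUnit_of_dvd_unit (map_dvd _ (Finset.dvd_prod_of_mem _ (Finset.mem_univ d))) h

/-- The ring homomorphism `O[[t]] → A((t_•))`, `s ↦ s(t_d)`. -/
noncomputable def inVarHom (d : D) : O⟦X⟧ →+* MvLaurent D A :=
  ((algebraMap (MvPowerSeries D A) (MvLaurent D A)).comp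
    (PowerSeries.substAlgHom (R := A) (PowerSeries.HasSubst.of_constantCoeff_zero
      (a := (MvPowerSeries.X d : MvPowerSeries D A)) (by simp))).toRingHom).comp (PowerSeries.map ι)

lemma inVarHom_apply (d : D) (s : O⟦X⟧) :
    inVarHom ι d s = algebraMap (MvPowerSeries D A) (MvLaurent D A) (inVar ι s d) := by
  simp only [inVarHom, inVar, RingHom.comp_apply, AlgHom.toRingHom_eq_coe, RingHom.coe_coe,
    PowerSeries.coe_substAlgHom]

lemma isNilpotent_inVarHom_C {π : O} (hι : IsNilpotent (ι π)) (d : D) :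
    IsNilpotent (inVarHom ι d (PowerSeries.C π)) := by
  have h : PowerSeries.map ι (PowerSeries.C π) = PowerSeries.C (ι π) := by simp
  rw [inVarHom, RingHom.comp_apply, h]
  exact (hι.map PowerSeries.C).map _

end Ring

section Monoid

variable {O : Type*} [CommRing O] {D : Type*}

/-- The monoid freely generated by commuting copies `φ_d` (of `φ`) and `Γ_d` (of `Γ = Oˣ`), for
`d ∈ D`: the element `∏_d φ_d ^ (n_d) γ_d` is the family of the pairs `(n_d, γ_d)`. -/
abbrev PhiGammaMonoid (O : Type*) [CommRing O] (D : Type*) : Type _ := D → Multiplicative ℕ × Oˣ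

/-- The element `γ_d π ^ (n_d)` of `O` through which `φ_d ^ (n_d) γ_d` acts: since `[π]_Φ = Φ`, the
endomorphism `φ_d ^ (n_d) γ_d` is insertion of `[γ_d π ^ (n_d)]_Φ(t_d)` for `t_d`. -/
def multiplier (π : O) (m : PhiGammaMonoid O D) (d : D) : O :=
  ((m d).2 : O) * π ^ Multiplicative.toAdd (m d).1

lemma multiplier_one {π : O} (d : D) : multiplier π (1 : PhiGammaMonoid O D) d = 1 := by
  simp [multiplier]

lemma multiplier_mul {π : O} (m m' : PhiGammaMonoid O D) (d : D) :
    multiplier π (m * m') d = multiplier π m' d * multiplier π m d := by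
  simp only [multiplier, Pi.mul_apply, Prod.fst_mul, Prod.snd_mul, toAdd_mul, Units.val_mul]
  ring

end Monoid

section Action

variable {O : Type*} [CommRing O] [IsDomain O] [IsDiscreteValuationRing O]
  [Finite (IsLocalRing.ResidueField O)] {π : O} {Φ : O⟦X⟧}
  (hπ : Irreducible π) (hΦ : IsLubinTateSeries π Φ)
  {A : Type*} [CommRing A] {ι : O →+* A} (hι : IsNilpotent (ι π))

lemma isUnit_inVarHom_pow (hι : IsNilpotent (ι π)) {D : Type*} [Fintype D] (d : D) (n : ℕ) :
    IsUnit (inVarHom ι d (lubinTateMul hπ hΦ (π ^ n))) := by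
  induction n with
  | zero =>
    rw [pow_zero, lubinTateMul_one, inVarHom_apply, inVar, PowerSeries.map_X,
      PowerSeries.subst_X (PowerSeries.HasSubst.of_constantCoeff_zero (by simp))]
    exact isUnit_algebraMap_X d
  | succ n ih =>
    have h0 := (lubinTateMul_spec hπ hΦ (π ^ n)).constantCoeff_eq
    have hs := PowerSeries.HasSubst.of_constantCoeff_zero' h0
    choose w hw using hΦ.dvd_coeff
    have hΦ' : Φ = PowerSeries.X ^ Nat.card (IsLocalRing.ResidueField O) +
        PowerSeries.C π * PowerSeries.mk w := by
      ext m
      rw [map_add, PowerSeries.coeff_C_mul, PowerSeries.coeff_mk, ← hw m, map_sub]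
      ring
    have hC : PowerSeries.subst (lubinTateMul hπ hΦ (π ^ n)) (PowerSeries.C π) =
        (PowerSeries.C π : O⟦X⟧) := PowerSeries.subst_C π
    rw [pow_succ', lubinTateMul_mul, lubinTateMul_uniformizer]
    have hsub : PowerSeries.subst (lubinTateMul hπ hΦ (π ^ n)) Φ =
        PowerSeries.subst (lubinTateMul hπ hΦ (π ^ n))
          (PowerSeries.X ^ Nat.card (IsLocalRing.ResidueField O) +
            PowerSeries.C π * PowerSeries.mk w) := congrArg _ hΦ'
    rw [hsub, PowerSeries.subst_add hs, PowerSeries.subst_mul hs, PowerSeries.subst_pow hs,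
      PowerSeries.subst_X hs, hC]
    have h1 := isNilpotent_inVarHom_C ι hι d
    have h2 := ih.pow (Nat.card (IsLocalRing.ResidueField O))
    have h3 : inVarHom ι d (lubinTateMul hπ hΦ (π ^ n) ^ Nat.card (IsLocalRing.ResidueField O) +
        PowerSeries.C π * PowerSeries.subst (lubinTateMul hπ hΦ (π ^ n)) (PowerSeries.mk w)) =
        inVarHom ι d (lubinTateMul hπ hΦ (π ^ n)) ^ Nat.card (IsLocalRing.ResidueField O) +
        inVarHom ι d (PowerSeries.C π) * inVarHom ι d
          (PowerSeries.subst (lubinTateMul hπ hΦ (π ^ n)) (PowerSeries.mk w)) := by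
      rw [map_add, map_mul, map_pow]
    exact h3 ▸ ((Commute.all _ _).isNilpotent_mul_right h1).isUnit_add_left_of_commute h2
      (Commute.all _ _)

lemma isUnit_inVarHom (hι : IsNilpotent (ι π)) {D : Type*} [Fintype D] (d : D) (n : ℕ) (γ : Oˣ) :
    IsUnit (inVarHom ι d (lubinTateMul hπ hΦ (γ * π ^ n))) := by
  have h0 := (lubinTateMul_spec hπ hΦ (π ^ n)).constantCoeff_eq
  have hs := PowerSeries.HasSubst.of_constantCoeff_zero' h0
  have hγ := lubinTateMul_spec hπ hΦ (γ : O)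
  obtain ⟨v, hv⟩ := PowerSeries.X_dvd_iff.mpr hγ.constantCoeff_eq
  have hv1 : v.constantCoeff = γ := by
    rw [← hγ.coeff_one_eq, hv]; simp
  have hvu : IsUnit v := by
    rw [PowerSeries.isUnit_iff_constantCoeff, hv1]
    exact γ.isUnit
  rw [lubinTateMul_mul, hv, PowerSeries.subst_mul hs, PowerSeries.subst_X hs]
  have h1 : IsUnit (PowerSeries.subst (lubinTateMul hπ hΦ (π ^ n)) v : O⟦X⟧) := by
    rw [← PowerSeries.coe_substAlgHom hs]
    exact hvu.map _
  exact (map_mul (inVarHom ι d) _ _) ▸ (isUnit_inVarHom_pow hπ hΦ hι d n).mul (h1.map _)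

variable {D : Type*} [Fintype D]

variable (ι) in
/-- The action of `φ_•` and `Γ_•` on `A[[t_•]]`: the element `m` inserts `[m_d]_Φ(t_d)` for `t_d`,
where `m_d ∈ O` is the multiplier of `m` at `d`. -/
noncomputable def powerSeriesEnd (m : PhiGammaMonoid O D) :
    MvPowerSeries D A →ₐ[A] MvPowerSeries D A :=
  substEnd ι (fun d => lubinTateMul hπ hΦ (multiplier π m d))
    fun _ => (lubinTateMul_spec hπ hΦ _).constantCoeff_eq

lemma isUnit_powerSeriesEnd (hι : IsNilpotent (ι π)) (m : PhiGammaMonoid O D) :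
    IsUnit (((algebraMap (MvPowerSeries D A) (MvLaurent D A)).comp
      (powerSeriesEnd hπ hΦ ι m).toRingHom) (∏ d : D, MvPowerSeries.X d)) := by
  rw [map_prod]
  refine Finset.prod_induction _ IsUnit (fun _ _ => IsUnit.mul) isUnit_one fun d _ => ?_
  have := isUnit_inVarHom hπ hΦ hι d (Multiplicative.toAdd (m d).1) (m d).2
  rw [inVarHom_apply] at this
  rw [RingHom.comp_apply, AlgHom.toRingHom_eq_coe, RingHom.coe_coe, powerSeriesEnd, substEnd_X]
  exact this

/-- The extension to `A((t_•))` of the action of `φ_•` and `Γ_•` on `A[[t_•]]`. -/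
noncomputable def laurentEnd (m : PhiGammaMonoid O D) : MvLaurent D A →+* MvLaurent D A :=
  IsLocalization.Away.lift (∏ d : D, (MvPowerSeries.X d : MvPowerSeries D A))
    (isUnit_powerSeriesEnd hπ hΦ hι m)

lemma laurentEnd_algebraMap (m : PhiGammaMonoid O D) (f : MvPowerSeries D A) :
    laurentEnd hπ hΦ hι m (algebraMap _ _ f) = algebraMap _ _ (powerSeriesEnd hπ hΦ ι m f) :=
  IsLocalization.Away.lift_eq _ _ _

/-- The action of `φ_•` and `Γ_•` on `A((t_•))`, as a homomorphism of monoids. -/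
noncomputable def laurentAction :
    PhiGammaMonoid O D →* (MvLaurent D A →+* MvLaurent D A) where
  toFun m := laurentEnd hπ hΦ hι m
  map_one' := by
    refine IsLocalization.ringHom_ext
      (Submonoid.powers (∏ d : D, (MvPowerSeries.X d : MvPowerSeries D A))) (RingHom.ext fun f => ?_)
    rw [RingHom.comp_apply, laurentEnd_algebraMap, powerSeriesEnd]
    simp only [multiplier_one, lubinTateMul_one]
    rw [substEnd_id]
    rfl
  map_mul' m m' := by
    refine IsLocalization.ringHom_ext
      (Submonoid.powers (∏ d : D, (MvPowerSeries.X d : MvPowerSeries D A))) (RingHom.ext fun f => ?_)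
    rw [RingHom.comp_apply, RingHom.comp_apply, RingHom.mul_def, RingHom.comp_apply,
      laurentEnd_algebraMap, laurentEnd_algebraMap, laurentEnd_algebraMap]
    congr 1
    simp only [powerSeriesEnd, multiplier_mul, lubinTateMul_mul]
    rw [substEnd_comp]
    exact fun d => constantCoeff_subst' (lubinTateMul_spec hπ hΦ _).constantCoeff_eq
      (lubinTateMul_spec hπ hΦ _).constantCoeff_eq

end Action

section Ring

variable {O : Type*} [CommRing O] [IsDomain O] [IsDiscreteValuationRing O]
  [Finite (IsLocalRing.ResidueField O)] {π : O} {Φ : O⟦X⟧}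
  {A : Type*} [CommRing A] {ι : O →+* A}

/-- The ring `A((t_•))[φ_•, Γ_•]`: the skew monoid algebra over `A((t_•))` on the monoid generated
by the `φ_d` and the `Γ_d`. It is the free left `A((t_•))`-module on that monoid, with
`m · f = (m * f) · m` for `f ∈ A((t_•))`. -/
def PhiGammaRing (_hπ : Irreducible π) (_hΦ : IsLubinTateSeries π Φ) (_hι : IsNilpotent (ι π))
    (D : Type*) [Fintype D] : Type _ :=
  SkewMonoidAlgebra (MvLaurent D A) (PhiGammaMonoid O D)

variable (hπ : Irreducible π) (hΦ : IsLubinTateSeries π Φ) (hι : IsNilpotent (ι π))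
  {D : Type*} [Fintype D]

noncomputable instance : Ring (PhiGammaRing hπ hΦ hι D) :=
  letI := MulSemiringAction.compHom (MvLaurent D A) (laurentAction (D := D) hπ hΦ hι)
  inferInstanceAs (Ring (SkewMonoidAlgebra (MvLaurent D A) (PhiGammaMonoid O D)))

variable (D) in
/-- The inclusion `A((t_•)) → A((t_•))[φ_•, Γ_•]`. -/
noncomputable def coeffHom : MvLaurent D A →+* PhiGammaRing hπ hΦ hι D :=
  letI := MulSemiringAction.compHom (MvLaurent D A) (laurentAction (D := D) hπ hΦ hι)
  SkewMonoidAlgebra.singleOneRingHom (k := MvLaurent D A) (G := PhiGammaMonoid O D)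

variable (D) in
/-- The inclusion of the monoid generated by the `φ_d` and the `Γ_d` into
`A((t_•))[φ_•, Γ_•]`. -/
noncomputable def monoidHom : PhiGammaMonoid O D →* PhiGammaRing hπ hΦ hι D :=
  letI := MulSemiringAction.compHom (MvLaurent D A) (laurentAction (D := D) hπ hΦ hι)
  SkewMonoidAlgebra.of (MvLaurent D A) (PhiGammaMonoid O D)

lemma monoidHom_mul_coeffHom (m : PhiGammaMonoid O D) (f : MvLaurent D A) :
    monoidHom hπ hΦ hι D m * coeffHom hπ hΦ hι D f =
      coeffHom hπ hΦ hι D (laurentAction hπ hΦ hι m f) * monoidHom hπ hΦ hι D m := by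
  let _ := MulSemiringAction.compHom (MvLaurent D A) (laurentAction (D := D) hπ hΦ hι)
  have h : (SkewMonoidAlgebra.single m 1 * SkewMonoidAlgebra.single 1 f :
      SkewMonoidAlgebra (MvLaurent D A) (PhiGammaMonoid O D)) =
      SkewMonoidAlgebra.single 1 (m • f) * SkewMonoidAlgebra.single m 1 := by
    rw [SkewMonoidAlgebra.single_mul_single, SkewMonoidAlgebra.single_mul_single]
    simp
  exact h

open Classical in
/-- The generator `φ_d`. -/
noncomputable def phi (d : D) : PhiGammaMonoid O D :=
  Pi.mulSingle d (Multiplicative.ofAdd 1, 1)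

open Classical in
/-- The generator `γ_d`, for `γ ∈ Γ = Oˣ`. -/
noncomputable def gam (d : D) (γ : Oˣ) : PhiGammaMonoid O D :=
  Pi.mulSingle d (1, γ)

/-- `φ_d` acts by `t_d ↦ Φ(t_d)`, and by `t_{d'} ↦ t_{d'}` for `d' ≠ d`. -/
lemma powerSeriesEnd_phi (d d' : D) [Decidable (d' = d)] :
    powerSeriesEnd hπ hΦ ι (phi d) (MvPowerSeries.X d') =
      if d' = d then inVar ι Φ d' else MvPowerSeries.X d' := by
  rw [powerSeriesEnd, substEnd_X]
  split_ifs with h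
  · subst h
    have : multiplier π (phi d' : PhiGammaMonoid O D) d' = π := by
      simp [multiplier, phi]
    rw [this, lubinTateMul_uniformizer]
  · have : multiplier π (phi d : PhiGammaMonoid O D) d' = 1 := by
      classical
      rw [multiplier, phi, Pi.mulSingle_eq_of_ne h]
      simp
    rw [this, lubinTateMul_one, inVar, PowerSeries.map_X,
      PowerSeries.subst_X (PowerSeries.HasSubst.of_constantCoeff_zero (by simp))]

/-- `γ_d` acts by `t_d ↦ [γ]_Φ(t_d)`, and by `t_{d'} ↦ t_{d'}` for `d' ≠ d`. -/
lemma powerSeriesEnd_gam (d d' : D) [Decidable (d' = d)] (γ : Oˣ) :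
    powerSeriesEnd hπ hΦ ι (gam d γ) (MvPowerSeries.X d') =
      if d' = d then inVar ι (lubinTateMul hπ hΦ γ) d' else MvPowerSeries.X d' := by
  rw [powerSeriesEnd, substEnd_X]
  split_ifs with h
  · subst h
    have : multiplier π (gam d' γ : PhiGammaMonoid O D) d' = γ := by
      simp [multiplier, gam]
    rw [this]
  · have : multiplier π (gam d γ : PhiGammaMonoid O D) d' = 1 := by
      classical
      rw [multiplier, gam, Pi.mulSingle_eq_of_ne h]
      simp
    rw [this, lubinTateMul_one, inVar, PowerSeries.map_X,
      PowerSeries.subst_X (PowerSeries.HasSubst.of_constantCoeff_zero (by simp))]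

end Ring

section Etale

/-- The ring `R`, regarded as an `R`-module through the ring endomorphism `σ`. -/
def Twist {R : Type*} [CommRing R] (_ : R →+* R) : Type _ := R

noncomputable instance {R : Type*} [CommRing R] (σ : R →+* R) : CommRing (Twist σ) :=
  inferInstanceAs (CommRing R)

noncomputable instance {R : Type*} [CommRing R] (σ : R →+* R) : Module R (Twist σ) :=
  Module.compHom R σ

/-- For a `σ`-semilinear map `φ : M → M`, the map `id ⊗ φ : R ⊗_{σ, R} M → M`,
`r ⊗ x ↦ r φ(x)`. -/
noncomputable def linearization {R : Type*} [CommRing R] (σ : R →+* R) {M : Type*}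
    [AddCommGroup M] [Module R M] (φ : M →ₛₗ[σ] M) : Twist σ ⊗[R] M →+ M :=
  TensorProduct.liftAddHom
    ({ toFun := fun r => (DistribSMul.toAddMonoidHom M r).comp φ.toAddMonoidHom
       map_zero' := AddMonoidHom.ext fun x => zero_smul R (φ x)
       map_add' := fun r s => AddMonoidHom.ext fun x => add_smul r s (φ x) } : R →+ M →+ M)
    fun a (r : R) x => by
      change (σ a * r) • φ x = r • φ (a • x)
      rw [map_smulₛₗ, smul_smul, mul_comm]

variable {O : Type*} [CommRing O] [IsDomain O] [IsDiscreteValuationRing O]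
  [Finite (IsLocalRing.ResidueField O)] {π : O} {Φ : O⟦X⟧}
  (hπ : Irreducible π) (hΦ : IsLubinTateSeries π Φ)
  {A : Type*} [CommRing A] {ι : O →+* A} (hι : IsNilpotent (ι π))
  (D : Type*) [Fintype D]

/-- The underlying `A((t_•))`-module of an `A((t_•))[φ_•, Γ_•]`-module. -/
noncomputable abbrev underlying (M : ModuleCat.{v} (PhiGammaRing hπ hΦ hι D)) :
    ModuleCat.{v} (MvLaurent D A) :=
  (ModuleCat.restrictScalars (coeffHom hπ hΦ hι D)).obj M

variable {D}

/-- The semilinear action of `φ_d` on an `A((t_•))[φ_•, Γ_•]`-module. -/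
noncomputable def phiAction (M : ModuleCat.{v} (PhiGammaRing hπ hΦ hι D)) (d : D) :
    underlying hπ hΦ hι D M →ₛₗ[laurentAction hπ hΦ hι (phi d)] underlying hπ hΦ hι D M where
  toFun x := (monoidHom hπ hΦ hι D (phi d) • (x : M) : M)
  map_add' x y := smul_add (monoidHom hπ hΦ hι D (phi d)) (x : M) (y : M)
  map_smul' r x := by
    change monoidHom hπ hΦ hι D (phi d) • (coeffHom hπ hΦ hι D r • (x : M)) =
      coeffHom hπ hΦ hι D (laurentAction hπ hΦ hι (phi d) r) •
        (monoidHom hπ hΦ hι D (phi d) • (x : M))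
    rw [smul_smul, smul_smul, monoidHom_mul_coeffHom]

variable (D)

/-- An `A((t_•))[φ_•, Γ_•]`-module is étale if it is finitely generated over `A((t_•))` and all its
linearized maps `id ⊗ φ_d : A((t_•)) ⊗_{φ_d, A((t_•))} M → M` are bijective. -/
def IsEtale : ObjectProperty (ModuleCat.{v} (PhiGammaRing hπ hΦ hι D)) := fun M =>
  Module.Finite (MvLaurent D A) (underlying hπ hΦ hι D M) ∧
    ∀ d : D, Function.Bijective
      (linearization (laurentAction hπ hΦ hι (phi d)) (phiAction hπ hΦ hι M d))

/-- The category of étale `(φ_•, Γ_•)`-modules over `A((t_•))`, a full subcategory of the category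
of `A((t_•))[φ_•, Γ_•]`-modules. -/
abbrev EtalePhiGammaModule : Type _ := (IsEtale.{v} hπ hΦ hι D).FullSubcategory

end Etale

end LubinTate

/-! Étale modules form a full subcategory of all modules over the skew monoid ring, which is an
abelian category. It is therefore enough that étaleness passes to kernels, cokernels and finite
products and holds for zero. The action of `Γ` and the commutation relations need no attention: they
come with the ambient kernels and cokernels, and étaleness only concerns the `A((t_•))`-module and
the operators `φ_d`.

Finite generation passes to quotients trivially, and to submodules because `A((t_•))` is noetherian,
being a localization of a power series ring in finitely many variables over a finite ring.
Bijectivity of `id ⊗ φ_d` passes to cokernels by right exactness of the tensor product and the five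
lemma. For kernels the functor `A((t_•)) ⊗_{φ_d} -` must also preserve injections, so the heart of
the matter is the flatness of `φ_d` (`flat_twist_phi`).

Flatness holds because `φ_d` is, modulo the image of `π` in `A`, the substitution `t_d ↦ t_d ^ q`,
and that image is nilpotent. For the pure substitution, `A[[t_•]]` is free over itself on `1, t_d,
…, t_d ^ (q - 1)`, by division of exponents with remainder (`bijective_residueSum_subst`). A
nilpotent error does not destroy bijectivity (`LinearMap.bijective_of_nilpotent_perturbation`), so
the same monomials remain a basis for `φ_d` itself. Localization carries flatness over to
`A((t_•))`. -/

/-! ### Nilpotent perturbations and flatness from a basis -/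

/-- Writing `T = T₀ ∘ (1 + S)`, the endomorphism `S` has image in `a M`, so `S ^ k` has image in `a
^ k M`. Hence `S` is nilpotent and `1 + S` is invertible. -/
lemma LinearMap.bijective_of_nilpotent_perturbation {A M N : Type*} [CommRing A] [AddCommGroup M]
    [Module A M] [AddCommGroup N] [Module A N] {T T₀ : M →ₗ[A] N} {a : A} (ha : IsNilpotent a)
    (h₀ : Function.Bijective T₀) (h : ∀ x, ∃ y, T x = T₀ x + a • y) : Function.Bijective T := by
  let e := LinearEquiv.ofBijective T₀ h₀
  let S : Module.End A M := e.symm.toLinearMap ∘ₗ T - 1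
  have hS : ∀ x, ∃ y, S x = a • y := fun x => by
    obtain ⟨y, hy⟩ := h x
    refine ⟨e.symm y, ?_⟩
    have : e.symm (T₀ x) = x := e.symm_apply_apply x
    simp [S, hy, this]
  have hSk : ∀ k x, ∃ y, (S ^ k) x = a ^ k • y := fun k => by
    induction k with
    | zero => exact fun x => ⟨x, by simp⟩
    | succ k ih =>
      intro x
      obtain ⟨y, hy⟩ := ih x
      obtain ⟨z, hz⟩ := hS y
      exact ⟨z, by rw [pow_succ', Module.End.mul_apply, hy, map_smul, hz, smul_smul, pow_succ]⟩
  have hnil : IsNilpotent S := by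
    obtain ⟨k, hk⟩ := ha
    refine ⟨k, LinearMap.ext fun x => ?_⟩
    obtain ⟨y, hy⟩ := hSk k x
    rw [hy, hk, zero_smul, LinearMap.zero_apply]
  have hb := (Module.End.isUnit_iff _).mp hnil.isUnit_one_add
  have hT : T = e.toLinearMap ∘ₗ (1 + S) := by
    ext x
    simp [S]
  rw [hT, LinearMap.coe_comp]
  exact e.bijective.comp hb

/-- The hypothesis says that `b` is a basis of `S` as an `R`-module through `ψ`, and free modules
are flat. -/
lemma RingHom.Flat.of_bijective_sum {R S I : Type*} [CommRing R] [CommRing S] [Fintype I]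
    (ψ : R →+* S) (b : I → S)
    (h : Function.Bijective fun f : I → R => ∑ i, ψ (f i) * b i) : ψ.Flat := by
  algebraize [ψ]
  let T : (I → R) →ₗ[R] S :=
    { toFun := fun f => ∑ i, ψ (f i) * b i
      map_add' := fun f g => by simp [add_mul, Finset.sum_add_distrib]
      map_smul' := fun r f => by
        simp only [Pi.smul_apply, smul_eq_mul, map_mul, RingHom.id_apply, Finset.smul_sum,
          mul_assoc]
        rfl }
  exact Module.Flat.of_linearEquiv (LinearEquiv.ofBijective T h).symm

/-! ### Freeness of a power series ring over itself along powers of the variables -/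

namespace MvPowerSeries

variable {D A : Type*} [CommRing A]

/-- The ideal is principal, so each coefficient can be divided by `a` separately, and any choice of
quotients is again a power series. -/
lemma exists_eq_smul_of_map_eq_zero {a : A} {g : MvPowerSeries D A}
    (h : map (Ideal.Quotient.mk (Ideal.span {a})) g = 0) : ∃ y, g = a • y := by
  have hc : ∀ n, ∃ c, coeff n g = a * c := fun n => by
    have := congrArg (coeff n) h
    rw [coeff_map, coeff_zero, Ideal.Quotient.eq_zero_iff_mem, Ideal.mem_span_singleton] at this
    exact this
  choose c hc using hc
  let y : MvPowerSeries D A := c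
  exact ⟨y, MvPowerSeries.ext fun n => by rw [coeff_smul, hc]; rfl⟩

variable [Fintype D] (e : D → ℕ)

lemma prod_X_pow (m : D →₀ ℕ) : (m.prod fun s k => ((X s : MvPowerSeries D A) ^ e s) ^ k) =
    monomial (Finsupp.equivFunOnFinite.symm fun s => e s * m s) 1 := by
  classical
  have h : ∀ S : Finset D, ∏ s ∈ S, (monomial (Finsupp.single s (e s * m s)) (1 : A)) =
      monomial (∑ s ∈ S, Finsupp.single s (e s * m s)) 1 := fun S => by
    induction S using Finset.induction_on with
    | empty => simp
    | insert s S hs ih =>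
      rw [Finset.prod_insert hs, Finset.sum_insert hs, ih, monomial_mul_monomial, one_mul]
  rw [Finsupp.prod_fintype _ _ (by simp)]
  simp only [← pow_mul]
  simp only [X_pow_eq, h]
  congr 2
  ext s
  simp [Finsupp.finsetSum_apply, Finsupp.single_apply]

/-- The exponent `r`, for a family `r` of residues modulo the `e s`. -/
noncomputable def residueExponent (r : ∀ s, Fin (e s)) : D →₀ ℕ :=
  Finsupp.equivFunOnFinite.symm fun s => r s

/-- The `A`-linear map sending a family `(f_r)` to the sum of the `ψ(f_r) X ^ r`, where `r` runs
through the exponents smaller than `e`. -/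
noncomputable def residueSum [DecidableEq D] (ψ : MvPowerSeries D A →ₐ[A] MvPowerSeries D A) :
    ((∀ s, Fin (e s)) → MvPowerSeries D A) →ₗ[A] MvPowerSeries D A where
  toFun f := ∑ r, ψ (f r) * monomial (residueExponent e r) 1
  map_add' f g := by simp [add_mul, Finset.sum_add_distrib]
  map_smul' c f := by simp [Finset.smul_sum]

lemma residueSum_apply [DecidableEq D] (ψ : MvPowerSeries D A →ₐ[A] MvPowerSeries D A)
    (f : (∀ s, Fin (e s)) → MvPowerSeries D A) :
    residueSum e ψ f = ∑ r, ψ (f r) * monomial (residueExponent e r) 1 := rfl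

variable [∀ s, NeZero (e s)]

lemma hasSubst_X_pow : HasSubst fun s => (X s : MvPowerSeries D A) ^ e s :=
  hasSubst_of_constantCoeff_zero fun s => by simp [NeZero.ne]

open Classical in
lemma coeff_subst_X_pow (f : MvPowerSeries D A) (n : D →₀ ℕ) :
    coeff n (subst (fun s => (X s : MvPowerSeries D A) ^ e s) f) =
      if ∀ s, e s ∣ n s then coeff (Finsupp.equivFunOnFinite.symm fun s => n s / e s) f else 0 := by
  rw [coeff_subst (hasSubst_X_pow e)]
  simp only [prod_X_pow, coeff_monomial]
  rw [finsum_eq_single _ (Finsupp.equivFunOnFinite.symm fun s => n s / e s)]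
  · by_cases h : ∀ s, e s ∣ n s
    · rw [if_pos, if_pos h, smul_eq_mul, mul_one]
      ext s
      simp [Nat.mul_div_cancel' (h s)]
    · rw [if_neg, if_neg h, smul_zero]
      contrapose! h
      intro s
      rw [h]
      simp
  · intro m hm
    rw [if_neg, smul_zero]
    contrapose! hm
    ext s
    simp [hm, Nat.mul_div_cancel_left _ (Nat.pos_of_neZero (e s))]

variable [DecidableEq D]

/-- Division with remainder in each variable: `n` has a unique expression `r + e m` with `r` smaller
than `e`, so only the summand indexed by `r = n mod e` contributes, through its coefficient at `m =
n / e`. -/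
lemma coeff_residueSum_subst (f : (∀ s, Fin (e s)) → MvPowerSeries D A) (n : D →₀ ℕ) :
    coeff n (residueSum e (substAlgHom (hasSubst_X_pow e)) f) =
      coeff (Finsupp.equivFunOnFinite.symm fun s => n s / e s)
        (f fun s => Fin.ofNat (e s) (n s)) := by
  rw [residueSum_apply, map_sum,
    Finset.sum_eq_single fun s => Fin.ofNat (e s) (n s)]
  · have h1 : residueExponent e (fun s => Fin.ofNat (e s) (n s)) ≤ n := fun s => by
      simpa [residueExponent] using Nat.mod_le _ _
    rw [coeff_mul_monomial, if_pos h1, mul_one, substAlgHom_apply, coeff_subst_X_pow, if_pos]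
    · congr 2
      ext s
      simp only [residueExponent, Finsupp.coe_tsub, Pi.sub_apply,
        Finsupp.equivFunOnFinite_symm_apply_apply, Fin.ofNat]
      exact Nat.div_eq_sub_mod_div.symm
    · intro s
      simpa [residueExponent] using Nat.dvd_sub_mod (n s)
  · intro r _ hr
    rw [coeff_mul_monomial]
    split_ifs with h1
    -- A nonzero contribution would require every `e s` to divide `n s - r s`; since `r s < e s`,
    -- this forces `r s` to be the remainder of `n s`.
    · rw [mul_one, substAlgHom_apply, coeff_subst_X_pow, if_neg]
      contrapose! hr
      funext s
      have h2 := hr s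
      have h3 := h1 s
      simp only [residueExponent, Finsupp.coe_tsub, Pi.sub_apply,
        Finsupp.equivFunOnFinite_symm_apply_apply] at h2 h3
      ext
      have := (Nat.modEq_iff_dvd' h3).mpr h2
      rw [Fin.val_ofNat, ← this, Nat.mod_eq_of_lt (r s).2]
    · rfl
  · simp

lemma bijective_residueSum_subst :
    Function.Bijective (residueSum (A := A) e (substAlgHom (hasSubst_X_pow e))) := by
  have hq : ∀ (r : ∀ s, Fin (e s)) (m : D →₀ ℕ) (s : D), (r s + e s * m s) / e s = m s :=
    fun r m s => by
      rw [Nat.add_mul_div_left _ _ (Nat.pos_of_neZero _), Nat.div_eq_of_lt (r s).2, zero_add]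
  have hr : ∀ (r : ∀ s, Fin (e s)) (m : D →₀ ℕ),
      (fun s => Fin.ofNat (e s) (r s + e s * m s)) = r := fun r m => by
    funext s
    ext
    simp [Nat.mod_eq_of_lt (r s).2]
  constructor
  · intro f g h
    funext r
    ext m
    have h1 := congrArg
      (coeff (Finsupp.equivFunOnFinite.symm fun s => (r s : ℕ) + e s * m s)) h
    rw [coeff_residueSum_subst, coeff_residueSum_subst] at h1
    simp only [Finsupp.equivFunOnFinite_symm_apply_apply, hq, hr] at h1
    simpa using h1
  · intro g
    -- The preimage sorts the coefficients of `g` by the residue class of their exponent.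
    let f : (∀ s, Fin (e s)) → MvPowerSeries D A := fun r m =>
      coeff (Finsupp.equivFunOnFinite.symm fun s => (r s : ℕ) + e s * m s) g
    refine ⟨f, ?_⟩
    ext n
    rw [coeff_residueSum_subst]
    change coeff _ g = coeff n g
    congr 2
    ext s
    simp [Nat.mod_add_div]

/-- An endomorphism which inserts a power of `X s` for each `X s`, up to a nilpotent error, is
flat. -/
lemma flat_of_nilpotent_perturbation {a : A} (ha : IsNilpotent a)
    (ψ : MvPowerSeries D A →ₐ[A] MvPowerSeries D A)
    (h : ∀ f, ∃ y, ψ f = subst (fun s => (X s : MvPowerSeries D A) ^ e s) f + a • y) :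
    ψ.toRingHom.Flat := by
  refine RingHom.Flat.of_bijective_sum _
    (fun r : ∀ s, Fin (e s) => (monomial (residueExponent e r) (1 : A))) ?_
  -- The basis property concerns combinations with coefficients twisted by `ψ`, but the comparison
  -- with the pure substitution only needs both maps to be `A`-linear.
  refine LinearMap.bijective_of_nilpotent_perturbation (T := residueSum e ψ) ha
    (bijective_residueSum_subst e) fun f => ?_
  choose y hy using fun r => h (f r)
  refine ⟨∑ r, y r * monomial (residueExponent e r) 1, ?_⟩
  simp only [residueSum_apply, substAlgHom_apply, hy, add_mul,
    Finset.sum_add_distrib, Finset.smul_sum, smul_mul_assoc]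

end MvPowerSeries

/-! ### Flatness of `φ_d` -/

namespace LubinTate

section Flat

variable {O : Type*} [CommRing O] {A : Type*} [CommRing A] {ι : O →+* A} {D : Type*}

lemma exists_inVar_eq [IsDomain O] [IsDiscreteValuationRing O] {π : O} {Φ : O⟦X⟧}
    (hΦ : IsLubinTateSeries π Φ) (d : D) :
    ∃ y : MvPowerSeries D A, inVar ι Φ d =
      MvPowerSeries.X d ^ Nat.card (IsLocalRing.ResidueField O) + MvPowerSeries.C (ι π) * y := by
  choose w hw using hΦ.dvd_coeff
  have hX : PowerSeries.HasSubst (MvPowerSeries.X d : MvPowerSeries D A) :=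
    PowerSeries.HasSubst.of_constantCoeff_zero (by simp)
  have hΦ' : Φ.map ι = PowerSeries.X ^ Nat.card (IsLocalRing.ResidueField O) +
      ι π • (PowerSeries.mk w).map ι := by
    ext m
    have := congrArg ι (hw m)
    rw [map_sub, map_sub, map_mul, sub_eq_iff_eq_add] at this
    rw [PowerSeries.coeff_map, this, map_add, PowerSeries.coeff_smul, PowerSeries.coeff_map,
      PowerSeries.coeff_mk, PowerSeries.coeff_X_pow, PowerSeries.coeff_X_pow, add_comm, smul_eq_mul]
    split_ifs <;> simp
  refine ⟨PowerSeries.subst (MvPowerSeries.X d) ((PowerSeries.mk w).map ι), ?_⟩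
  rw [inVar, hΦ', PowerSeries.subst_add hX, PowerSeries.subst_pow hX, PowerSeries.subst_X hX,
    PowerSeries.subst_smul hX, MvPowerSeries.smul_eq_C_mul]

variable [Fintype D]

variable [IsDomain O] [IsDiscreteValuationRing O]
  [Finite (IsLocalRing.ResidueField O)] {π : O} {Φ : O⟦X⟧}
  (hπ : Irreducible π) (hΦ : IsLubinTateSeries π Φ) (hι : IsNilpotent (ι π))

include hι in
-- The congruence `Φ ≡ t ^ q` modulo `π` makes `φ_d` a perturbation of `t_d ↦ t_d ^ q` by a multiple
-- of the nilpotent element `ι π`.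
lemma flat_powerSeriesEnd_phi (d : D) : (powerSeriesEnd hπ hΦ ι (phi d)).toRingHom.Flat := by
  classical
  let q := Nat.card (IsLocalRing.ResidueField O)
  have hq : q ≠ 0 := Nat.card_pos.ne'
  -- `φ_d` fixes the variables other than `t_d`, whence the exponent `1` there.
  let e : D → ℕ := fun s => if s = d then q else 1
  have : ∀ s, NeZero (e s) := fun s => ⟨by dsimp only [e]; split_ifs <;> simp [hq]⟩
  refine MvPowerSeries.flat_of_nilpotent_perturbation e hι _ fun f => ?_
  obtain ⟨y, hy⟩ := MvPowerSeries.exists_eq_smul_of_map_eq_zero (a := ι π)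
    (g := powerSeriesEnd hπ hΦ ι (phi d) f -
      MvPowerSeries.subst (fun s => (MvPowerSeries.X s : MvPowerSeries D A) ^ e s) f) (by
    have hs := hasSubst_inVar ι (D := D)
      (s := fun s => lubinTateMul hπ hΦ (multiplier π (phi d : PhiGammaMonoid O D) s))
      fun _ => (lubinTateMul_spec hπ hΦ _).constantCoeff_eq
    -- Reduction of coefficients commutes with substitution, so it suffices that the inserted series
    -- agree over `A / (ι π)`.
    have key : ∀ s, MvPowerSeries.map (Ideal.Quotient.mk (Ideal.span {ι π}))
        (inVar ι (lubinTateMul hπ hΦ (multiplier π (phi d : PhiGammaMonoid O D) s)) s) =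
        MvPowerSeries.map (Ideal.Quotient.mk (Ideal.span {ι π}))
          ((MvPowerSeries.X s : MvPowerSeries D A) ^ e s) := fun s => by
      have h1 := powerSeriesEnd_phi hπ hΦ (ι := ι) d s
      rw [powerSeriesEnd, substEnd_X] at h1
      rw [h1]
      by_cases h : s = d
      · obtain ⟨y, hy⟩ := exists_inVar_eq (A := A) (ι := ι) (D := D) hΦ s
        have h0 : Ideal.Quotient.mk (Ideal.span {ι π}) (ι π) = 0 :=
          Ideal.Quotient.eq_zero_iff_mem.mpr (Ideal.mem_span_singleton_self _)
        simp only [e, if_pos h, hy, map_add, map_mul, MvPowerSeries.map_C, h0, map_zero, zero_mul,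
          add_zero, q]
      · simp only [e, if_neg h, pow_one]
    rw [map_sub, sub_eq_zero, powerSeriesEnd, substEnd, MvPowerSeries.substAlgHom_apply,
      MvPowerSeries.map_subst hs, MvPowerSeries.map_subst (MvPowerSeries.hasSubst_X_pow e)]
    simp only [key])
  exact ⟨y, sub_eq_iff_eq_add'.mp hy⟩

/-- Flatness of a module over the localization `A((t_•))` can be tested over `A[[t_•]]`. There the
structure map factors as the flat endomorphism `φ_d` of `A[[t_•]]` followed by the flat map to the
localization. -/
lemma flat_twist_phi (d : D) :
    Module.Flat (MvLaurent D A) (Twist (laurentAction (D := D) hπ hΦ hι (phi d))) := by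
  set σ := laurentAction (D := D) hπ hΦ hι (phi d) with hσ
  have h1 : (σ.comp (algebraMap (MvPowerSeries D A) (MvLaurent D A))).Flat := by
    have : σ.comp (algebraMap (MvPowerSeries D A) (MvLaurent D A)) =
        (algebraMap _ _).comp (powerSeriesEnd hπ hΦ ι (phi d)).toRingHom :=
      RingHom.ext fun f => laurentEnd_algebraMap hπ hΦ hι (phi d) f
    rw [this]
    refine (flat_powerSeriesEnd_phi hπ hΦ hι d).comp (RingHom.flat_algebraMap_iff.mpr ?_)
    exact IsLocalization.flat _
      (Submonoid.powers (∏ d : D, (MvPowerSeries.X d : MvPowerSeries D A)))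
  let : Module (MvPowerSeries D A) (Twist σ) :=
    Module.compHom (Twist σ) (algebraMap (MvPowerSeries D A) (MvLaurent D A))
  have : IsScalarTower (MvPowerSeries D A) (MvLaurent D A) (Twist σ) :=
    ⟨fun r s x => by rw [Algebra.smul_def, mul_smul]; rfl⟩
  rw [Module.flat_iff_of_isLocalization (R := MvPowerSeries D A) (MvLaurent D A)
    (Submonoid.powers (∏ d : D, (MvPowerSeries.X d : MvPowerSeries D A)))]
  exact h1

end Flat

end LubinTate

/-! ### Linearized maps in exact sequences -/

namespace LubinTate

section Linearization

variable {R : Type*} [CommRing R] {σ : R →+* R}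
  {M₁ M₂ M₃ : Type*} [AddCommGroup M₁] [AddCommGroup M₂] [AddCommGroup M₃]
  [Module R M₁] [Module R M₂] [Module R M₃]
  {φ₁ : M₁ →ₛₗ[σ] M₁} {φ₂ : M₂ →ₛₗ[σ] M₂} {φ₃ : M₃ →ₛₗ[σ] M₃}
  {f : M₁ →ₗ[R] M₂} {g : M₂ →ₗ[R] M₃}

/-- Naturality of `id ⊗ φ`, which supplies the commutative squares for the diagram chases below;
these take place in abelian groups. -/
lemma linearization_comp_lTensor (hf : ∀ x, f (φ₁ x) = φ₂ (f x)) :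
    f.toAddMonoidHom.comp (linearization σ φ₁) =
      (linearization σ φ₂).comp (f.lTensor (Twist σ)).toAddMonoidHom := by
  refine AddMonoidHom.ext fun x => ?_
  induction x using TensorProduct.induction_on with
  | zero => simp
  | add x y hx hy => rw [map_add, map_add, hx, hy]
  | tmul r x =>
    have h (s : R) : f (s • φ₁ x) = s • φ₂ (f x) := by rw [map_smul, hf]
    exact h r

variable (hf : ∀ x, f (φ₁ x) = φ₂ (f x)) (hg : ∀ x, g (φ₂ x) = φ₃ (g x))
  (hfg : Function.Exact f g)

include hf hg hfg in
-- The case of kernels: flatness keeps the tensored row left exact, and the five lemma applies.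
lemma bijective_linearization_of_left_exact [Module.Flat R (Twist σ)]
    (hinj : Function.Injective f) (h₂ : Function.Bijective (linearization σ φ₂))
    (h₃ : Function.Bijective (linearization σ φ₃)) :
    Function.Bijective (linearization σ φ₁) :=
  AddMonoidHom.bijective_of_bijective_of_injective_of_left_exact
    (f.lTensor (Twist σ)).toAddMonoidHom (g.lTensor (Twist σ)).toAddMonoidHom
    f.toAddMonoidHom g.toAddMonoidHom _ _ _
    (linearization_comp_lTensor hf) (linearization_comp_lTensor hg)
    (Module.Flat.lTensor_exact (Twist σ) hfg) hfg h₂ h₃.1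
    (Module.Flat.lTensor_preserves_injective_linearMap f hinj) hinj

include hf hg hfg in
-- The case of cokernels: tensoring is always right exact, so flatness plays no role.
lemma bijective_linearization_of_right_exact
    (hsurj : Function.Surjective g) (h₁ : Function.Bijective (linearization σ φ₁))
    (h₂ : Function.Bijective (linearization σ φ₂)) :
    Function.Bijective (linearization σ φ₃) :=
  AddMonoidHom.bijective_of_surjective_of_bijective_of_right_exact
    (f.lTensor (Twist σ)).toAddMonoidHom (g.lTensor (Twist σ)).toAddMonoidHom
    f.toAddMonoidHom g.toAddMonoidHom _ _ _
    (linearization_comp_lTensor hf) (linearization_comp_lTensor hg)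
    (lTensor_exact (Twist σ) hfg hsurj) hfg h₁.2 h₂
    (LinearMap.lTensor_surjective (Twist σ) hsurj) hsurj

include hf hg hfg in
lemma bijective_linearization_of_shortExact [Module.Flat R (Twist σ)]
    (hinj : Function.Injective f) (hsurj : Function.Surjective g)
    (h₁ : Function.Bijective (linearization σ φ₁))
    (h₃ : Function.Bijective (linearization σ φ₃)) :
    Function.Bijective (linearization σ φ₂) := by
  have hinj' := Module.Flat.lTensor_preserves_injective_linearMap (M := Twist σ) f hinj
  have hsurj' := LinearMap.lTensor_surjective (Twist σ) hsurj
  -- Five lemma, with both short exact rows padded by the trivial group `Unit` at either end.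
  refine AddMonoidHom.bijective_of_surjective_of_bijective_of_bijective_of_injective
    (0 : Unit →+ _) (f.lTensor (Twist σ)).toAddMonoidHom (g.lTensor (Twist σ)).toAddMonoidHom
    (0 : _ →+ Unit) (0 : Unit →+ _) f.toAddMonoidHom g.toAddMonoidHom (0 : _ →+ Unit)
    0 _ _ _ 0 (AddMonoidHom.ext fun _ => by simp) (linearization_comp_lTensor hf) (linearization_comp_lTensor hg) rfl
    (fun x => ?_) (Module.Flat.lTensor_exact (Twist σ) hfg) (fun x => ?_)
    (fun x => ?_) hfg (fun x => ?_) (fun _ => ⟨0, rfl⟩) h₁ h₃ fun _ _ _ => rfl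
  · exact (map_eq_zero_iff _ hinj').trans ⟨fun h => ⟨0, h.symm⟩, fun ⟨_, h⟩ => h.symm⟩
  · exact ⟨fun _ => hsurj' x, fun _ => rfl⟩
  · exact (map_eq_zero_iff _ hinj).trans ⟨fun h => ⟨0, h.symm⟩, fun ⟨_, h⟩ => h.symm⟩
  · exact ⟨fun _ => hsurj x, fun _ => rfl⟩

end Linearization

/-! ### Closure properties of étale modules -/

section Closure

variable {O : Type*} [CommRing O] [IsDomain O] [IsDiscreteValuationRing O]
  [Finite (IsLocalRing.ResidueField O)] {π : O} {Φ : O⟦X⟧}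
  (hπ : Irreducible π) (hΦ : IsLubinTateSeries π Φ)
  {A : Type*} [CommRing A] {ι : O →+* A} (hι : IsNilpotent (ι π))
  (D : Type*) [Fintype D]

variable {D} in
/-- The `A((t_•))`-linear map underlying a morphism of `A((t_•))[φ_•, Γ_•]`-modules. -/
noncomputable def underlyingMap {M N : ModuleCat.{v} (PhiGammaRing hπ hΦ hι D)} (f : M ⟶ N) :
    underlying hπ hΦ hι D M →ₗ[MvLaurent D A] underlying hπ hΦ hι D N :=
  ((ModuleCat.restrictScalars (coeffHom hπ hΦ hι D)).map f).hom

variable {D} in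
lemma underlyingMap_phiAction {M N : ModuleCat.{v} (PhiGammaRing hπ hΦ hι D)} (f : M ⟶ N) (d : D)
    (x : underlying hπ hΦ hι D M) :
    underlyingMap hπ hΦ hι f (phiAction hπ hΦ hι M d x) =
      phiAction hπ hΦ hι N d (underlyingMap hπ hΦ hι f x) :=
  f.hom.map_smul _ _

instance isNoetherianRing_mvLaurent [IsNoetherianRing A] : IsNoetherianRing (MvLaurent D A) :=
  IsLocalization.isNoetherianRing
    (Submonoid.powers (∏ d : D, (MvPowerSeries.X d : MvPowerSeries D A))) _ inferInstance

/-- Noetherianity of `A((t_•))` gives finite generation of the submodule, and flatness of `φ_d`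
gives bijectivity of the linearized maps. -/
lemma isEtale_of_left_exact [IsNoetherianRing A]
    (S : ShortComplex (ModuleCat.{v} (PhiGammaRing hπ hΦ hι D))) (hS : S.Exact) [Mono S.f]
    (h₂ : IsEtale hπ hΦ hι D S.X₂) (h₃ : IsEtale hπ hΦ hι D S.X₃) :
    IsEtale hπ hΦ hι D S.X₁ := by
  have hinj : Function.Injective (underlyingMap hπ hΦ hι S.f) :=
    (ModuleCat.mono_iff_injective S.f).mp inferInstance
  refine ⟨?_, fun d => ?_⟩
  · have := h₂.1
    exact Module.Finite.of_injective (underlyingMap hπ hΦ hι S.f) hinj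
  · have := flat_twist_phi (D := D) hπ hΦ hι d
    exact bijective_linearization_of_left_exact (underlyingMap_phiAction hπ hΦ hι S.f d)
      (underlyingMap_phiAction hπ hΦ hι S.g d)
      ((ShortComplex.ShortExact.moduleCat_exact_iff_function_exact S).mp hS) hinj (h₂.2 d) (h₃.2 d)

lemma isEtale_of_right_exact
    (S : ShortComplex (ModuleCat.{v} (PhiGammaRing hπ hΦ hι D))) (hS : S.Exact) [Epi S.g]
    (h₁ : IsEtale hπ hΦ hι D S.X₁) (h₂ : IsEtale hπ hΦ hι D S.X₂) :
    IsEtale hπ hΦ hι D S.X₃ := by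
  have hsurj : Function.Surjective (underlyingMap hπ hΦ hι S.g) :=
    (ModuleCat.epi_iff_surjective S.g).mp inferInstance
  refine ⟨?_, fun d => ?_⟩
  · have := h₂.1
    exact Module.Finite.of_surjective (underlyingMap hπ hΦ hι S.g) hsurj
  · exact bijective_linearization_of_right_exact (underlyingMap_phiAction hπ hΦ hι S.f d)
      (underlyingMap_phiAction hπ hΦ hι S.g d)
      ((ShortComplex.ShortExact.moduleCat_exact_iff_function_exact S).mp hS) hsurj (h₁.2 d) (h₂.2 d)

/-- Needed for finite products: a biproduct is a (split) extension of its factors. -/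
instance isClosedUnderExtensions_isEtale :
    (IsEtale.{v} hπ hΦ hι D).IsClosedUnderExtensions where
  prop_X₂_of_shortExact {S} hS h₁ h₃ := by
    have hinj : Function.Injective (underlyingMap hπ hΦ hι S.f) := hS.moduleCat_injective_f
    have hsurj : Function.Surjective (underlyingMap hπ hΦ hι S.g) := hS.moduleCat_surjective_g
    have hex : Function.Exact (underlyingMap hπ hΦ hι S.f) (underlyingMap hπ hΦ hι S.g) :=
      (ShortComplex.ShortExact.moduleCat_exact_iff_function_exact S).mp hS.exact
    refine ⟨?_, fun d => ?_⟩
    · have := h₁.1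
      have := h₃.1
      exact Module.Finite.of_exact hex hsurj
    · have := flat_twist_phi (D := D) hπ hΦ hι d
      exact bijective_linearization_of_shortExact (underlyingMap_phiAction hπ hΦ hι S.f d)
        (underlyingMap_phiAction hπ hΦ hι S.g d) hex hinj hsurj (h₁.2 d) (h₃.2 d)

instance isClosedUnderKernels_isEtale [IsNoetherianRing A] :
    (IsEtale.{v} hπ hΦ hι D).IsClosedUnderKernels where
  kernels_le := by
    rintro _ ⟨f, k, hk, hX, hY⟩
    have : Mono k.ι := Limits.Fork.IsLimit.mono hk
    exact isEtale_of_left_exact hπ hΦ hι D (ShortComplex.mk k.ι f k.condition)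
      (ShortComplex.exact_of_f_is_kernel _
        (Limits.IsLimit.ofIsoLimit hk (Limits.Fork.ext (Iso.refl _)))) hX hY

instance isClosedUnderCokernels_isEtale :
    (IsEtale.{v} hπ hΦ hι D).IsClosedUnderCokernels where
  cokernels_le := by
    rintro _ ⟨f, k, hk, hX, hY⟩
    have : Epi k.π := Limits.Cofork.IsColimit.epi hk
    exact isEtale_of_right_exact hπ hΦ hι D (ShortComplex.mk f k.π k.condition)
      (ShortComplex.exact_of_g_is_cokernel _
        (Limits.IsColimit.ofIsoColimit hk (Limits.Cofork.ext (Iso.refl _)))) hX hY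

lemma isEtale_of_isZero (M : ModuleCat.{v} (PhiGammaRing hπ hΦ hι D)) (hM : Limits.IsZero M) :
    IsEtale hπ hΦ hι D M := by
  have h : Subsingleton (underlying hπ hΦ hι D M)  :=
    ModuleCat.subsingleton_of_isZero (M := M) hM
  refine ⟨inferInstance, fun d => ⟨fun x y _ => ?_, fun x => ⟨0, h.elim _ _⟩⟩⟩
  have h0 : ∀ z : Twist (laurentAction hπ hΦ hι (phi d)) ⊗[MvLaurent D A]
      underlying hπ hΦ hι D M, z = 0 := fun z => by
    induction z using TensorProduct.induction_on with
    | zero => rfl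
    | tmul r m => rw [h.elim m 0, TensorProduct.tmul_zero]
    | add z w hz hw => rw [hz, hw, add_zero]
  rw [h0 x, h0 y]

instance containsZero_isEtale : (IsEtale.{v} hπ hΦ hι D).ContainsZero :=
  ⟨⟨_, Limits.isZero_zero _, isEtale_of_isZero hπ hΦ hι D _ (Limits.isZero_zero _)⟩⟩

open scoped ZeroObject in
instance isClosedUnderIsomorphisms_isEtale :
    (IsEtale.{v} hπ hΦ hι D).IsClosedUnderIsomorphisms where
  of_iso {X Y} i hX := by
    have hz := isEtale_of_isZero hπ hΦ hι D _ (Limits.isZero_zero _)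
    -- A module isomorphic to `X` is a cokernel of `0 ⟶ X`.
    exact isEtale_of_right_exact hπ hΦ hι D (ShortComplex.mk (0 : 0 ⟶ X) i.hom (by simp))
      ((ShortComplex.exact_iff_mono _ rfl).mpr inferInstance) hz hX

instance isClosedUnderFiniteProducts_isEtale :
    (IsEtale.{v} hπ hΦ hι D).IsClosedUnderFiniteProducts := by
  have : (IsEtale.{v} hπ hΦ hι D).IsClosedUnderBinaryProducts := by
    refine ObjectProperty.IsClosedUnderLimitsOfShape.mk' ?_
    rintro _ ⟨F, hF⟩
    exact (IsEtale.{v} hπ hΦ hι D).prop_of_iso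
      ((Limits.biprod.isoProd _ _) ≪≫ (Limits.HasLimit.isoOfNatIso (Limits.diagramIsoPair F)).symm)
      ((IsEtale.{v} hπ hΦ hι D).prop_biprod (hF ⟨.left⟩) (hF ⟨.right⟩))
  exact ObjectProperty.IsClosedUnderFiniteProducts.mk'

end Closure

end LubinTate

/-! ### The category of étale modules is abelian -/

theorem mainTheorem4 {p : ℕ} [Fact p.Prime]
    {F : Type*} [Field F] [Algebra ℚ_[p] F] [FiniteDimensional ℚ_[p] F]
    [Algebra ℤ_[p] F] [IsScalarTower ℤ_[p] ℚ_[p] F]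
    {K : Type*} [Field K] [Algebra ℚ_[p] K] [FiniteDimensional ℚ_[p] K]
    [Algebra ℤ_[p] K] [IsScalarTower ℤ_[p] ℚ_[p] K]
    [Algebra F K] [IsScalarTower ℚ_[p] F K]
    {π : integralClosure ℤ_[p] F} (hπ : Irreducible π)
    {Φ : PowerSeries (integralClosure ℤ_[p] F)} (hΦ : LubinTate.IsLubinTateSeries π Φ)
    {A : Type*} [CommRing A] [Finite A]
    {f : integralClosure ℤ_[p] K →+* A} (hf : Function.Surjective f)
    (D : Type*) [Fintype D] :
    ∃ h : Abelian (LubinTate.EtalePhiGammaModule.{v} hπ hΦ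
        (LubinTate.isNilpotent_uniformizer hπ hf) D),
      h.toPreadditive = Preadditive.fullSubcategory _ := by
  have : IsNoetherianRing A := inferInstance
  -- The closure properties make the full subcategory abelian; the equality records that its
  -- addition of morphisms is the one inherited from modules.
  exact ⟨inferInstance, rfl⟩
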